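/- For positive integers $n,t$, a universal cycle for the $t$-multisets of $[n]=\{1,\dots,n\}$ is a cyclic sequence of $\binom{n+t-1}{t}$ elements of $[n]$ such that every $t$-multiset of $[n]$ (a multiset of $t$ elements of $[n]$, repetitions allowed) appears exactly once as the multiset of entries of $t$ cyclically consecutive terms of the sequence. Let $n_0(3)=4$, $n_0(4)=5$ and $n_0(6)=11$. Then for every $t\in\{3,4,6\}$ and every integer $n\ge n_0(t)$ with $\gcd(n,t)=1$, there exists a universal cycle for the $t$-multisets of $[n]$. -/

import Mathlib

/-- A universal cycle for the `t`-multisets of an `n`-element set (represented by `Fin n`):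
a cyclic sequence of length `binom (n + t - 1) t`, that is, a sequence indexed by the integers
modulo this number, such that every multiset of `t` elements (with repetition allowed) is the
multiset of entries of exactly one block of `t` cyclically consecutive terms. -/
def IsMcycle (n t : ℕ) (a : ZMod ((n + t - 1).choose t) → Fin n) : Prop :=
  ∀ s : Multiset (Fin n), Multiset.card s = t →
    ∃! i : ZMod ((n + t - 1).choose t),
      (Multiset.range t).map (fun j : ℕ => a (i + (j : ZMod ((n + t - 1).choose t)))) = s

/-- The thresholds `n₀(3) = 4`, `n₀(4) = 5`, `n₀(6) = 11`; only these three values are used. -/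
def nZero : ℕ → ℕ
  | 3 => 4
  | 4 => 5
  | 6 => 11
  | _ => 0

/-! Identify `[n]` with `ZMod n` and put `t = k + 1`. A `t`-multiset on the circle is given by a
starting point and its `t` cyclic gaps, which sum to `n`. If some gap has multiplicity one, a rule
that sees only the multiset of gaps can choose such a gap. Cutting the circle there leaves a
canonical block: a starting point and `k` differences (`window_bijective`). Selected lists are
closed under permutation, so rotating the differences pairs incoming with outgoing edges in the
graph whose edges are blocks and whose vertices are overlaps of blocks. An Euler tour of this graph
is a universal cycle (`exists_isMcycle_of_selection`). Its connectivity reduces to joining every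
selected list to the zero list by single-entry replacements (`Block.connected`).

For `t = 3, 4, 6`, gaps that all have multiplicity at least two have a sum sharing a factor with
`t`, so coprimality supplies a gap of multiplicity one. Under the rule `pick`, a list whose omitted
gap is positive reaches zero by clearing a largest entry first. If the omitted gap is `0`, no entry
of the list is simple. The few such shapes are treated by hand, and the thresholds enter there. -/

section EulerTour

/-! ### Euler tours as successor permutations of the edges. -/

variable {E V : Type*}

/-- Composing with a transposition of two points in different cycles merges these cycles. -/
theorem sameCycle_mul_swap [Finite E] [DecidableEq E] (σ : Equiv.Perm E) {a e f : E} (he : σ.SameCycle a e)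
    (hf : ¬ σ.SameCycle a f) {x : E} (hx : σ.SameCycle a x ∨ x = f) :
    (σ * Equiv.swap e f).SameCycle a x := by
  set τ := σ * Equiv.swap e f with hτ
  have τe : τ e = σ f := by simp [hτ]
  have τf : τ f = σ e := by simp [hτ]
  have τo : ∀ y, y ≠ e → y ≠ f → τ y = σ y := fun y h₁ h₂ => by
    simp [hτ, Equiv.swap_apply_of_ne_of_ne h₁ h₂]
  -- Finiteness turns forward invariance under `τ` into backward invariance.
  have surj : ∀ S : Set E, (∀ y ∈ S, τ y ∈ S) → ∀ y, τ y ∈ S → y ∈ S := by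
    intro S hS y hy
    have hb : Set.BijOn τ S S :=
      ((Set.toFinite S).injOn_iff_bijOn_of_mapsTo hS).1 τ.injective.injOn
    obtain ⟨z, hz, hzy⟩ := hb.surjOn hy
    exact τ.injective hzy ▸ hz
  have hiff : τ.SameCycle a e ↔ τ.SameCycle a f := by
    constructor
    · intro h
      by_contra hn
      -- The part of the `τ`-cycle outside the `σ`-cycle would be `τ`-invariant and contain `τ e = σ
      -- f`, hence also `e`.
      refine (surj {y | τ.SameCycle a y ∧ ¬ σ.SameCycle a y} ?_ e ?_).2 he
      · rintro y ⟨h₁, h₂⟩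
        refine ⟨Equiv.Perm.sameCycle_apply_right.2 h₁, ?_⟩
        rw [τo y (by rintro rfl; exact h₂ he) (by rintro rfl; exact hn h₁)]
        rwa [Equiv.Perm.sameCycle_apply_right]
      · refine ⟨Equiv.Perm.sameCycle_apply_right.2 h, ?_⟩
        rwa [τe, Equiv.Perm.sameCycle_apply_right]
    · intro h
      by_contra hn
      refine hf (surj {y | τ.SameCycle a y ∧ σ.SameCycle a y} ?_ f ?_).2
      · rintro y ⟨h₁, h₂⟩
        refine ⟨Equiv.Perm.sameCycle_apply_right.2 h₁, ?_⟩
        rw [τo y (by rintro rfl; exact hn h₁) (by rintro rfl; exact hf h₂)]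
        rwa [Equiv.Perm.sameCycle_apply_right]
      · refine ⟨Equiv.Perm.sameCycle_apply_right.2 h, ?_⟩
        rwa [τf, Equiv.Perm.sameCycle_apply_right]
  have hclosed : ∀ y, τ.SameCycle a y → τ.SameCycle a (σ y) := by
    intro y hy
    by_cases h₁ : y = e
    · subst h₁
      rw [← τf, Equiv.Perm.sameCycle_apply_right]
      exact hiff.1 hy
    by_cases h₂ : y = f
    · subst h₂
      rw [← τe, Equiv.Perm.sameCycle_apply_right]
      exact hiff.2 hy
    rw [← τo y h₁ h₂, Equiv.Perm.sameCycle_apply_right]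
    exact hy
  have hall : ∀ y, σ.SameCycle a y → τ.SameCycle a y := by
    intro y hy
    obtain ⟨i, rfl⟩ := hy.exists_nat_pow_eq
    clear hy
    induction i with
    | zero => exact Equiv.Perm.SameCycle.refl _ _
    | succ i ih => rw [pow_succ']; exact hclosed _ ih
  rcases hx with hx | rfl
  · exact hall x hx
  · exact hiff.1 (hall e he)

/-- A finite directed multigraph with an in-out pairing of its edges (`σ₀`) and with
all edges connected to `a` has an Euler tour, given as the successor permutation of its edges. -/
theorem exists_eulerTour [Finite E] (tail head : E → V) (σ₀ : Equiv.Perm E)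
    (hσ₀ : ∀ e, tail (σ₀ e) = head e) (a : E)
    (hconn : ∀ S : Set E, a ∈ S → (∀ e f, tail f = head e → (e ∈ S ↔ f ∈ S)) → ∀ e, e ∈ S) :
    ∃ σ : Equiv.Perm E, (∀ e, tail (σ e) = head e) ∧ ∀ e, σ.SameCycle a e := by
  classical
  -- Take a pairing whose cycle through `a` is largest. If one of two edges into a common vertex lay
  -- outside it, a swap would enlarge it.
  obtain ⟨σ, hσ, hmax⟩ := Set.exists_max_image {σ : Equiv.Perm E | ∀ e, tail (σ e) = head e}
    (fun σ => {x | σ.SameCycle a x}.ncard) (Set.toFinite _) ⟨σ₀, hσ₀⟩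
  have key : ∀ e f, head e = head f → σ.SameCycle a e → σ.SameCycle a f := by
    intro e f hef he
    by_contra hf
    have h := hmax (σ * Equiv.swap e f) (by
      intro y
      rw [Equiv.Perm.mul_apply, hσ]
      by_cases h₁ : y = e
      · subst h₁; simp [hef]
      by_cases h₂ : y = f
      · subst h₂; simp [hef]
      rw [Equiv.swap_apply_of_ne_of_ne h₁ h₂])
    refine absurd h (not_le.2 (Set.ncard_lt_ncard ?_ (Set.toFinite _)))
    refine Set.ssubset_iff_exists.2 ⟨fun x hx => sameCycle_mul_swap σ he hf (Or.inl hx), f,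
      sameCycle_mul_swap σ he hf (Or.inr rfl), hf⟩
  refine ⟨σ, hσ, hconn {x | σ.SameCycle a x} (Equiv.Perm.SameCycle.refl _ _) ?_⟩
  intro e f hef
  have h : head e = head (σ.symm f) := by
    rw [← hσ (σ.symm f), Equiv.apply_symm_apply, hef]
  have h2 : σ.SameCycle a (σ.symm f) ↔ σ.SameCycle a f :=
    Equiv.Perm.sameCycle_symm_apply_right
  exact ⟨fun he => h2.1 (key _ _ h he), fun hf => key _ _ h.symm (h2.2 hf)⟩

/-- A permutation with a single cycle enumerates its domain cyclically. -/
theorem exists_equiv_zmod_of_sameCycle (σ : Equiv.Perm E) (a : E) (h : ∀ e, σ.SameCycle a e)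
    {N : ℕ} (hN : Nat.card E = N) :
    ∃ φ : ZMod N ≃ E, ∀ i, φ (i + 1) = σ (φ i) := by
  have horb : ∀ e, e ∈ MulAction.orbit (Subgroup.zpowers σ) a := by
    intro e
    obtain ⟨i, hi⟩ := h e
    exact ⟨⟨σ ^ i, i, rfl⟩, hi⟩
  let ψ : ZMod (Function.minimalPeriod (σ • ·) a) ≃ E :=
    (MulAction.orbitZPowersEquiv σ a).symm.trans (Equiv.subtypeUnivEquiv horb)
  have hψ : ∀ k : ℤ, ψ k = (σ ^ k) a := by
    intro k
    simp only [ψ, Equiv.trans_apply, MulAction.orbitZPowersEquiv_symm_apply']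
    rfl
  have hcard : Function.minimalPeriod (σ • ·) a = N := by
    rw [← hN, ← Nat.card_congr ψ, Nat.card_zmod]
  clear_value ψ
  generalize Function.minimalPeriod (σ • ·) a = p at ψ hcard
  subst hcard
  refine ⟨ψ, fun i => ?_⟩
  obtain ⟨k, rfl⟩ := ZMod.intCast_surjective i
  have : ((k : ZMod p) + 1) = ((k + 1 : ℤ) : ZMod p) := by push_cast; rfl
  rw [this, hψ, hψ, add_comm, zpow_add, zpow_one, Equiv.Perm.mul_apply]

end EulerTour

/-! ### Multisets of residues encoded by their cyclic gaps. -/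

section GapLists

variable {n k : ℕ} {ρ : Multiset ℕ → ℕ}

/-- The successive positions visited in `ZMod n` when starting at `x` and making the steps listed,
without the final position. -/
def walk : ZMod n → List ℕ → List (ZMod n)
  | _, [] => []
  | x, d :: L => x :: walk (x + d) L

theorem walk_append (x : ZMod n) (A B : List ℕ) :
    walk x (A ++ B) = walk x A ++ walk (x + ((A.sum : ℕ) : ZMod n)) B := by
  induction A generalizing x with
  | nil => simp [walk]
  | cons d A ih => rw [List.cons_append, walk, walk, ih, List.sum_cons, Nat.cast_add, add_assoc,
      List.cons_append]

@[simp] theorem length_walk (x : ZMod n) (L : List ℕ) : (walk x L).length = L.length := by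
  induction L generalizing x with
  | nil => rfl
  | cons d L ih => simp [walk, ih]

theorem walk_concat (x : ZMod n) (l : List ℕ) (c : ℕ) :
    walk x (l ++ [c]) = walk x l ++ [x + ((l.sum : ℕ) : ZMod n)] := by
  simp [walk_append, walk]

/-- The block of consecutive terms that starts at `x` and has the differences listed. -/
def window (x : ZMod n) (l : List ℕ) : List (ZMod n) := walk x l ++ [x + ((l.sum : ℕ) : ZMod n)]

theorem window_cons (x : ZMod n) (d : ℕ) (l : List ℕ) :
    window x (d :: l) = x :: window (x + d) l := by
  rw [window, window, walk, List.sum_cons, Nat.cast_add, add_assoc, List.cons_append]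

theorem exists_walk_eq_map (b : ℕ) (ys : List ℕ) : ∀ a : ℕ, (a :: ys).Pairwise (· ≤ ·) →
    (∀ y ∈ a :: ys, y ≤ b) → ∃ L : List ℕ, L.length = ys.length + 1 ∧ a + L.sum = b ∧
      walk (a : ZMod n) L = (a :: ys).map (fun y : ℕ => (y : ZMod n)) := by
  induction ys with
  | nil =>
    intro a _ h
    have := h a (by simp)
    exact ⟨[b - a], by simp, by simp; omega, by simp [walk]⟩
  | cons c ys ih =>
    intro a hs h
    rw [List.pairwise_cons] at hs
    obtain ⟨L, h₁, h₂, h₃⟩ := ih c hs.2 (fun y hy => h y (List.mem_cons_of_mem _ hy))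
    have hac : a ≤ c := hs.1 c (by simp)
    refine ⟨(c - a) :: L, by simp [h₁], by simp; omega, ?_⟩
    have : (a : ZMod n) + ((c - a : ℕ) : ZMod n) = (c : ℕ) := by
      rw [← Nat.cast_add]; congr 1; omega
    rw [walk, this, h₃]
    rfl

/-- Every nonempty multiset of residues is visited by a closed walk going round once. -/
theorem exists_closed_walk [NeZero n] (s : Multiset (ZMod n)) (hs : Multiset.card s = k + 1) :
    ∃ (x : ZMod n) (L : List ℕ), L.length = k + 1 ∧ L.sum = n ∧
      (walk x L : Multiset (ZMod n)) = s := by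
  have hlen : ((s.map ZMod.val).sort (· ≤ ·)).length = k + 1 := by simp [hs]
  have hsort := (s.map ZMod.val).pairwise_sort (· ≤ ·)
  have hcoe := (s.map ZMod.val).sort_eq (· ≤ ·)
  generalize (s.map ZMod.val).sort (· ≤ ·) = Y at hlen hsort hcoe
  cases Y with
  | nil => simp at hlen
  | cons a ys =>
    have hlt : ∀ y ∈ a :: ys, y < n := by
      intro y hy
      have : y ∈ s.map ZMod.val := by rw [← hcoe]; exact hy
      obtain ⟨z, _, rfl⟩ := Multiset.mem_map.1 this
      exact z.val_lt
    -- The target `a + n` makes the last step the wrap-around gap.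
    obtain ⟨L, h₁, h₂, h₃⟩ := exists_walk_eq_map (n := n) (a + n) ys a hsort
      (fun y hy => (hlt y hy).le.trans (Nat.le_add_left _ _))
    refine ⟨a, L, by simpa [h₁] using hlen, by omega, ?_⟩
    rw [h₃, ← Multiset.map_coe, hcoe, Multiset.map_map]
    simp

/-- A list of differences is selected by `ρ` if `ρ` picks the remaining gap out of the multiset
of all gaps around the circle. -/
def Selected (n k : ℕ) (ρ : Multiset ℕ → ℕ) (l : List ℕ) : Prop :=
  l.length = k ∧ l.sum ≤ n ∧ ρ ((n - l.sum) ::ₘ (l : Multiset ℕ)) = n - l.sum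

theorem Selected.perm {l l' : List ℕ} (h : Selected n k ρ l) (hl : l.Perm l') :
    Selected n k ρ l' := by
  obtain ⟨h₁, h₂, h₃⟩ := h
  rw [hl.sum_eq] at h₂ h₃
  exact ⟨hl.length_eq ▸ h₁, h₂, by rwa [← Multiset.coe_eq_coe.2 hl]⟩

/-- Cut the closed walk `A ++ r :: B` at the chosen gap `r` and start just after it, which gives the
differences `B ++ A`. -/
theorem exists_window_eq [NeZero n] (hρ : ∀ D : Multiset ℕ, Multiset.card D = k + 1 → D.sum = n →
    D.count (ρ D) = 1) (s : Multiset (ZMod n)) (hs : Multiset.card s = k + 1) :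
    ∃ (x : ZMod n) (l : List ℕ), Selected n k ρ l ∧ (window x l : Multiset (ZMod n)) = s := by
  obtain ⟨x, L, hL, hsum, rfl⟩ := exists_closed_walk s hs
  have hc := hρ L (by simpa using hL) (by simpa using hsum)
  have hmem : ρ L ∈ L := Multiset.mem_coe.1 (Multiset.count_pos.1 (by omega))
  obtain ⟨A, B, hAB⟩ := List.append_of_mem hmem
  generalize hr : ρ L = r at hAB
  have hsum' : A.sum + (r + B.sum) = n := by rw [← hsum, hAB]; simp
  have hr' : n - (B ++ A).sum = r := by simp; omega
  refine ⟨x + (((A ++ [r] : List ℕ).sum : ℕ) : ZMod n), B ++ A, ⟨?_, by simp; omega, ?_⟩, ?_⟩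
  · rw [hAB] at hL; simp at hL ⊢; omega
  · have : (r ::ₘ ((B ++ A : List ℕ) : Multiset ℕ)) = L := by
      rw [hAB, Multiset.cons_coe, Multiset.coe_eq_coe]
      exact (List.perm_append_comm.cons r).trans List.perm_middle.symm
    rw [hr', this, hr]
  · rw [window, ← walk_concat _ _ r, List.append_assoc, walk_append, hAB,
      show A ++ r :: B = (A ++ [r]) ++ B by simp, walk_append x]
    have : x + (((A ++ [r] : List ℕ).sum : ℕ) : ZMod n) + ((B.sum : ℕ) : ZMod n) = x := by
      have h : ((A.sum + (r + B.sum) : ℕ) : ZMod n) = 0 := by rw [hsum']; simp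
      rw [Nat.cast_add, Nat.cast_add] at h
      rw [List.sum_append, List.sum_singleton, Nat.cast_add]
      linear_combination h
    rw [this, Multiset.coe_eq_coe]
    exact List.perm_append_comm

/-- The selected gap occurs only once, so its position in the cyclic sequence of gaps fixes the
rotation. -/
theorem Selected.rotate_inj (hρ : ∀ D : Multiset ℕ, Multiset.card D = k + 1 → D.sum = n →
    D.count (ρ D) = 1) {l l' : List ℕ} (hl : Selected n k ρ l) (hl' : Selected n k ρ l') {m : ℕ}
    (hm : m < k + 1)
    (h : (n - l.sum) :: l = ((n - l'.sum) :: l').rotate m) : m = 0 ∧ l = l' := by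
  have hperm : ((n - l.sum) ::ₘ (l : Multiset ℕ)) = (n - l'.sum) ::ₘ (l' : Multiset ℕ) := by
    rw [Multiset.cons_coe, Multiset.cons_coe, Multiset.coe_eq_coe, h]
    exact List.rotate_perm _ _
  have hr : n - l.sum = n - l'.sum := by
    rw [← hl.2.2, ← hl'.2.2, hperm]
  cases m with
  | zero => simpa [hr] using h
  | succ m =>
    exfalso
    have hc := hρ ((n - l'.sum) ::ₘ (l' : Multiset ℕ)) (by simp [hl'.1])
      (by have := hl'.2.1; simp; omega)
    rw [hl'.2.2, Multiset.count_cons_self] at hc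
    have hnot : n - l'.sum ∉ l' := by
      rw [← Multiset.mem_coe, ← Multiset.count_eq_zero]
      omega
    rw [List.rotate_eq_drop_append_take (by simp [hl'.1]; omega), hr, List.drop_succ_cons,
      List.take_succ_cons] at h
    have hd : l'.drop m ≠ [] := by
      rw [Ne, List.drop_eq_nil_iff, hl'.1]; omega
    obtain ⟨c, C, hC⟩ := List.exists_cons_of_ne_nil hd
    rw [hC, List.cons_append, List.cons.injEq] at h
    exact hnot (List.mem_of_mem_drop (i := m) (by rw [hC, h.1]; simp))

theorem sum_getElem_fin {L : List ℕ} {m : ℕ} (hL : L.length = m) :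
    ∑ i : Fin m, L[(i : ℕ)]'(by omega) = L.sum := by
  subst hL
  rw [← List.sum_ofFn]
  simp

/-- The gaps around the circle, read from any of the `k + 1` starting points. -/
def gapTuple (n k : ℕ) (ρ : Multiset ℕ → ℕ) (p : {l : List ℕ // Selected n k ρ l} × Fin (k + 1)) :
    {P : Fin (k + 1) → ℕ // ∑ i, P i = n} :=
  ⟨fun i => (((n - p.1.1.sum) :: p.1.1).rotate p.2)[(i : ℕ)]'(by
      simpa [p.1.2.1] using Nat.le_of_lt_succ i.2), by
    have hlen : (((n - p.1.1.sum) :: p.1.1).rotate p.2).length = k + 1 := by simp [p.1.2.1]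
    have hsum : (((n - p.1.1.sum) :: p.1.1).rotate p.2).sum = n := by
      rw [(List.rotate_perm _ _).sum_eq]
      have := p.1.2.2.1
      simp; omega
    conv_rhs => rw [← hsum]
    exact sum_getElem_fin hlen⟩

theorem gapTuple_injective (hρ : ∀ D : Multiset ℕ, Multiset.card D = k + 1 → D.sum = n →
    D.count (ρ D) = 1) : Function.Injective (gapTuple n k ρ) := by
  have key : ∀ (l l' : {l : List ℕ // Selected n k ρ l}) (i j : Fin (k + 1)), i ≤ j →
      ((n - l.1.sum) :: l.1).rotate i = ((n - l'.1.sum) :: l'.1).rotate j → l = l' ∧ i = j := by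
    intro l l' i j hij h
    have hj : (j : ℕ) = (j - i : ℕ) + i := by have : (i : ℕ) ≤ j := hij; omega
    rw [hj, ← List.rotate_rotate] at h
    have := Selected.rotate_inj hρ l.2 l'.2 (m := j - i) (by omega) (List.rotate_injective _ h)
    exact ⟨Subtype.ext this.2, Fin.ext (by omega)⟩
  rintro ⟨l, i⟩ ⟨l', j⟩ h
  have hl : ((n - l.1.sum) :: l.1).rotate i = ((n - l'.1.sum) :: l'.1).rotate j := by
    refine List.ext_getElem (by simp [l.2.1, l'.2.1]) fun m hm _ => ?_
    have := congrFun (congrArg Subtype.val h) ⟨m, by simpa [l.2.1] using hm⟩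
    exact this
  rcases le_total i j with hij | hij
  · obtain ⟨rfl, rfl⟩ := key l l' i j hij hl; rfl
  · obtain ⟨rfl, rfl⟩ := key l' l j i hij hl.symm; rfl

theorem finite_selected (hρ : ∀ D : Multiset ℕ, Multiset.card D = k + 1 → D.sum = n →
    D.count (ρ D) = 1) : Finite {l : List ℕ // Selected n k ρ l} := by
  have : Finite {P : Fin (k + 1) → ℕ // ∑ i, P i = n} :=
    Finite.of_equiv _ (Sym.equivNatSumOfFintype (Fin (k + 1)) n)
  exact Finite.of_injective (fun l => gapTuple n k ρ (l, 0))
    fun a b h => (Prod.ext_iff.1 (gapTuple_injective hρ h)).1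

/-- The `k + 1` rotations inject into the weak compositions of `n` into `k + 1` parts, which number
`C(n+k, k)`, and `n * C(n+k, k) = (k+1) * C(n+k, k+1)`. The bound makes the surjection onto
multisets a bijection. -/
theorem card_selected_le [NeZero n] (hρ : ∀ D : Multiset ℕ, Multiset.card D = k + 1 → D.sum = n →
    D.count (ρ D) = 1) :
    n * Nat.card {l : List ℕ // Selected n k ρ l} ≤ (n + (k + 1) - 1).choose (k + 1) := by
  have : Finite {P : Fin (k + 1) → ℕ // ∑ i, P i = n} :=
    Finite.of_equiv _ (Sym.equivNatSumOfFintype (Fin (k + 1)) n)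
  have h := Nat.card_le_card_of_injective _ (gapTuple_injective hρ)
  rw [← Nat.card_congr (Sym.equivNatSumOfFintype (Fin (k + 1)) n), Nat.card_prod,
    Nat.card_eq_fintype_card (α := Sym _ _), Sym.card_sym_eq_choose,
    Nat.card_fin, Fintype.card_fin] at h
  have h₁ : (k + 1 + n - 1).choose n = (n + k).choose k := by
    rw [show k + 1 + n - 1 = n + k by omega, ← Nat.choose_symm_add]
  have h₂ := Nat.choose_succ_right_eq (n + k) k
  rw [h₁] at h
  rw [show n + k - k = n by omega] at h₂
  rw [show n + (k + 1) - 1 = n + k by omega]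
  refine Nat.le_of_mul_le_mul_right (c := k + 1) ?_ (by omega)
  rw [h₂, mul_assoc, mul_comm]
  exact Nat.mul_le_mul_right _ h

/-- Sending a starting point and a selected list of differences to the multiset of the block they
determine is a bijection. -/
theorem window_bijective [NeZero n] (hρ : ∀ D : Multiset ℕ, Multiset.card D = k + 1 → D.sum = n →
    D.count (ρ D) = 1) : Function.Bijective
      (fun e : ZMod n × {l : List ℕ // Selected n k ρ l} =>
        (⟨window e.1 e.2.1, by simp [window, e.2.2.1]⟩ : Sym (ZMod n) (k + 1))) := by
  have := finite_selected hρ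
  refine Function.Surjective.bijective_of_nat_card_le ?_ ?_
  · rintro ⟨s, hs⟩
    obtain ⟨x, l, hl, h⟩ := exists_window_eq hρ s hs
    exact ⟨(x, ⟨l, hl⟩), Subtype.ext h⟩
  · change _ ≤ Nat.card (Sym (ZMod n) (k + 1))
    rw [Nat.card_prod, Nat.card_zmod, Nat.card_eq_fintype_card (α := Sym _ _),
      Sym.card_sym_eq_choose, ZMod.card]
    exact card_selected_le hρ

end GapLists

/-! ### The transition graph and its connectivity. -/

section Reduction

variable {n k : ℕ} {ρ : Multiset ℕ → ℕ}

/-- Two selected lists of differences that differ in one entry. -/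
def SelectedStep (n k : ℕ) (ρ : Multiset ℕ → ℕ) (l l' : List ℕ) : Prop :=
  Selected n k ρ l ∧ Selected n k ρ l' ∧
    ∃ (A B : List ℕ) (c c' : ℕ), l = A ++ c :: B ∧ l' = A ++ c' :: B

/-- An edge of the transition graph: a starting point and a selected list of differences. -/
abbrev Block (n k : ℕ) (ρ : Multiset ℕ → ℕ) := ZMod n × {l : List ℕ // Selected n k ρ l}

/-- The block without its last term. -/
def Block.tail (e : Block n k ρ) : ZMod n × List ℕ := (e.1, e.2.1.dropLast)

/-- The block without its first term. -/
def Block.head (e : Block n k ρ) : ZMod n × List ℕ := (e.1 + (e.2.1.headD 0 : ℕ), e.2.1.tail)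

/-- Moving to the next block by repeating the list of differences periodically. -/
def Block.rotate (e : Block n k ρ) : Block n k ρ :=
  (e.1 + (e.2.1.headD 0 : ℕ), ⟨e.2.1.rotate 1, e.2.2.perm (List.rotate_perm _ _).symm⟩)

theorem Block.rotate_injective : Function.Injective (Block.rotate (n := n) (k := k) (ρ := ρ)) := by
  rintro ⟨x, l, hl⟩ ⟨y, l', hl'⟩ h
  simp only [Block.rotate, Prod.mk.injEq, Subtype.mk.injEq] at h
  obtain ⟨h₁, h₂⟩ := h
  obtain rfl := List.rotate_injective 1 h₂
  simpa using h₁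

theorem Block.tail_rotate (hk : 0 < k) (e : Block n k ρ) : e.rotate.tail = e.head := by
  obtain ⟨x, l, hl⟩ := e
  cases l with
  | nil => exact absurd hl.1 (by simp; omega)
  | cons d l => simp [Block.rotate, Block.tail, Block.head]

/-- Consecutive blocks overlap in all but one term. -/
theorem window_getElem_succ (hk : 0 < k) {e f : Block n k ρ} (h : f.tail = e.head) {j : ℕ}
    (hj : j < k) :
    (window f.1 f.2.1)[j]'(by simp [window, f.2.2.1]; omega) =
      (window e.1 e.2.1)[j + 1]'(by simp [window, e.2.2.1]; omega) := by
  obtain ⟨x, l, hl⟩ := e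
  obtain ⟨y, l', hl'⟩ := f
  cases l with
  | nil => exact absurd hl.1 (by simp; omega)
  | cons d l =>
    rcases List.eq_nil_or_concat' l' with rfl | ⟨m, c, rfl⟩
    · exact absurd hl'.1 (by simp; omega)
    simp only [Block.tail, Block.head, List.dropLast_concat, List.headD_cons, List.tail_cons,
      Prod.mk.injEq] at h
    obtain ⟨rfl, rfl⟩ := h
    have hm : m.length + 1 = k := by simpa using hl.1
    simp only [window_cons, List.getElem_cons_succ]
    have h₁ : window (x + (d : ZMod n)) (m ++ [c]) = window (x + (d : ZMod n)) m ++
        [x + d + (((m ++ [c]).sum : ℕ) : ZMod n)] := by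
      rw [window, walk_concat, window]
    simp only [h₁]
    rw [List.getElem_append_left]

/-- If single replacements connect all selected lists of differences to the zero list, then the
transition graph is connected. -/
theorem Block.connected [NeZero n]
    (hone : Selected n k ρ (1 :: List.replicate (k - 1) 0))
    (hzero : Selected n k ρ (List.replicate k 0))
    (hstep : ∀ l, Selected n k ρ l →
      Relation.ReflTransGen (SelectedStep n k ρ) l (List.replicate k 0))
    (S : Set (Block n k ρ)) (h₀ : ((0, ⟨_, hzero⟩) : Block n k ρ) ∈ S)
    (hS : ∀ e f : Block n k ρ, f.tail = e.head → (e ∈ S ↔ f ∈ S)) (e : Block n k ρ) : e ∈ S := by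
  set P : ZMod n → List ℕ → Prop := fun x l => ∃ h : Selected n k ρ l, (x, ⟨l, h⟩) ∈ S with hP
  -- Rotating by one place follows an edge of the graph, with the starting point moving along.
  have hrot : ∀ (A B : List ℕ) (x : ZMod n),
      P x (A ++ B) ↔ P (x + ((A.sum : ℕ) : ZMod n)) (B ++ A) := by
    intro A
    induction A with
    | nil => intro B x; simp
    | cons d A ih =>
      intro B x
      have h₁ : P x (d :: (A ++ B)) ↔ P (x + d) (A ++ B ++ [d]) := by
        constructor
        · rintro ⟨h, hx⟩
          refine ⟨h.perm (List.perm_append_singleton _ _).symm, ?_⟩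
          exact (hS _ _ (by simp [Block.tail, Block.head])).1 hx
        · rintro ⟨h, hx⟩
          refine ⟨h.perm (List.perm_append_singleton _ _), ?_⟩
          exact (hS _ _ (by simp [Block.tail, Block.head])).2 hx
      rw [List.cons_append, h₁, List.append_assoc, ih, List.sum_cons, Nat.cast_add, add_assoc,
        List.append_assoc]
      rfl
  -- Blocks that differ only in the last difference have the same tail, hence a common predecessor.
  -- Rotation brings any other entry to the last place.
  have hlast : ∀ (x : ZMod n) (m : List ℕ) (c c' : ℕ), Selected n k ρ (m ++ [c']) →
      P x (m ++ [c]) → P x (m ++ [c']) := by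
    rintro x m c c' hc' ⟨h, hx⟩
    refine ⟨hc', ?_⟩
    have hsel : Selected n k ρ (c :: m) := h.perm (List.perm_append_singleton _ _)
    have hpre := (hS (x - c, ⟨c :: m, hsel⟩) (x, ⟨m ++ [c], h⟩)
      (by simp [Block.tail, Block.head])).2 hx
    exact (hS (x - c, ⟨c :: m, hsel⟩) (x, ⟨m ++ [c'], hc'⟩)
      (by simp [Block.tail, Block.head])).1 hpre
  have hrepl : ∀ x l l', SelectedStep n k ρ l l' → (P x l ↔ P x l') := by
    have hconj : ∀ (x : ZMod n) (A B : List ℕ) (c : ℕ),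
        P x (A ++ c :: B) ↔ P (x - ((B.sum : ℕ) : ZMod n)) ((B ++ A) ++ [c]) := by
      intro x A B c
      have := hrot B (A ++ [c]) (x - ((B.sum : ℕ) : ZMod n))
      rw [sub_add_cancel] at this
      rw [List.append_assoc, this]
      simp
    rintro x _ _ ⟨h, h', A, B, c, c', rfl, rfl⟩
    have hp : ∀ c, (A ++ c :: B).Perm ((B ++ A) ++ [c]) := by
      intro c
      refine (List.perm_append_comm (l₁ := A) (l₂ := c :: B)).trans ?_
      exact (List.perm_append_singleton c (B ++ A)).symm
    rw [hconj x A B c, hconj x A B c']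
    exact ⟨hlast _ _ _ _ (h'.perm (hp c')), hlast _ _ _ _ (h.perm (hp c))⟩
  have hred : ∀ x l, Selected n k ρ l → (P x l ↔ P x (List.replicate k 0)) := by
    intro x l hl
    have h := hstep l hl
    generalize List.replicate k 0 = z at h
    induction h with
    | refl => rfl
    | tail _ h ih => exact ih.trans (hrepl x _ _ h)
  -- Rotating `1, 0, …, 0` by one place advances the starting point by one, which links the zero
  -- lists at all starting points.
  have hshift : ∀ x, P x (List.replicate k 0) → P (x + 1) (List.replicate k 0) := by
    intro x hx
    rw [← hred x _ hone] at hx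
    have h := (hrot [1] (List.replicate (k - 1) 0) x).1 hx
    have h' := (hred _ _ (hone.perm (List.perm_append_singleton 1 _).symm)).1 h
    simpa using h'
  have hall : ∀ m : ℕ, P (m : ZMod n) (List.replicate k 0) := by
    intro m
    induction m with
    | zero => exact ⟨hzero, by simpa using h₀⟩
    | succ m ih => simpa using hshift _ ih
  obtain ⟨x, l, hl⟩ := e
  have hx : P x l := by
    rw [hred x l hl, ← ZMod.natCast_zmod_val x]
    exact hall _
  exact hx.2

/-- A selection rule whose selected lists are connected by single replacements
yields a universal cycle. -/
theorem exists_isMcycle_of_selection [NeZero n] (hk : 0 < k)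
    (hρ : ∀ D : Multiset ℕ, Multiset.card D = k + 1 → D.sum = n → D.count (ρ D) = 1)
    (hone : Selected n k ρ (1 :: List.replicate (k - 1) 0))
    (hzero : Selected n k ρ (List.replicate k 0))
    (hstep : ∀ l, Selected n k ρ l →
      Relation.ReflTransGen (SelectedStep n k ρ) l (List.replicate k 0)) :
    ∃ a : ZMod ((n + (k + 1) - 1).choose (k + 1)) → Fin n, IsMcycle n (k + 1) a := by
  have hfin := finite_selected hρ
  have hbij := window_bijective hρ
  have hcard : Nat.card (Block n k ρ) = (n + (k + 1) - 1).choose (k + 1) := by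
    refine (Nat.card_congr (Equiv.ofBijective _ hbij)).trans ?_
    rw [show Nat.card {s : Multiset (ZMod n) // Multiset.card s = k + 1} =
      Nat.card (Sym (ZMod n) (k + 1)) from rfl, Nat.card_eq_fintype_card,
      Sym.card_sym_eq_choose, ZMod.card]
  obtain ⟨σ, hσ, hcyc⟩ := exists_eulerTour Block.tail Block.head
    (Equiv.ofBijective _ (Finite.injective_iff_bijective.1 Block.rotate_injective))
    (Block.tail_rotate hk) ((0, ⟨_, hzero⟩) : Block n k ρ)
    (Block.connected hone hzero hstep)
  obtain ⟨φ, hφ⟩ := exists_equiv_zmod_of_sameCycle σ _ hcyc hcard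
  have hw : ∀ (j : ℕ) (hj : j < k + 1) i,
      (window (φ i).1 (φ i).2.1)[j]'(by simpa [window, (φ i).2.2.1] using Nat.le_of_lt_succ hj) =
        (φ (i + j)).1 := by
    intro j
    induction j with
    | zero =>
      intro _ i
      rcases hφi : (φ i) with ⟨x, l, hl'⟩
      cases l with
      | nil => exact absurd hl'.1 (by simp; omega)
      | cons d l => simp [window_cons, hφi]
    | succ j ih =>
      intro hj i
      have h := window_getElem_succ hk (hσ (φ i)) (j := j) (by omega)
      simp only [← hφ] at h
      rw [← h, ih (by omega), Nat.cast_succ, add_right_comm, add_assoc]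
  have hrange : ∀ i, (Multiset.range (k + 1)).map (fun j : ℕ => (φ (i + j)).1) =
      (window (φ i).1 (φ i).2.1 : Multiset (ZMod n)) := by
    intro i
    rw [← Multiset.coe_range, Multiset.map_coe]
    congr 1
    refine List.ext_getElem (by simp [window, (φ i).2.2.1]) fun j h₁ _ => ?_
    rw [hw j (by simpa using h₁)]
    simp
  let ψ := (ZMod.finEquiv n).toEquiv
  refine ⟨fun i => ψ.symm (φ i).1, fun s hs => ?_⟩
  have hiff : ∀ i, (Multiset.range (k + 1)).map (fun j : ℕ => ψ.symm (φ (i + j)).1) = s ↔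
      (window (φ i).1 (φ i).2.1 : Multiset (ZMod n)) = s.map ψ := by
    intro i
    rw [← hrange]
    constructor
    · rintro rfl
      simp
    · intro h
      have := congrArg (Multiset.map ψ.symm) h
      simpa using this
  simp only [hiff]
  obtain ⟨e, he, huniq⟩ := hbij.existsUnique ⟨s.map ψ, by simpa using hs⟩
  refine ⟨φ.symm e, by simpa using congrArg Subtype.val he, fun i hi => ?_⟩
  rw [← huniq (φ i) (Subtype.ext hi), Equiv.symm_apply_apply]

end Reduction

/-! ### The rule `pick` and paths to the zero list. -/

section SelectionRule

variable {n k : ℕ}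

/-- The elements of multiplicity one. -/
def simpleElems (D : Multiset ℕ) : Finset ℕ := D.toFinset.filter (fun c => D.count c = 1)

theorem mem_simpleElems {D : Multiset ℕ} {c : ℕ} : c ∈ simpleElems D ↔ D.count c = 1 := by
  rw [simpleElems, Finset.mem_filter, Multiset.mem_toFinset, and_iff_right_iff_imp]
  intro h
  exact Multiset.count_pos.1 (by omega)

/-- The largest element of multiplicity one if zero is present, the smallest one otherwise. -/
noncomputable def pick (D : Multiset ℕ) : ℕ :=
  if 0 ∈ D then (simpleElems D).sup id else sInf (simpleElems D : Set ℕ)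

theorem count_pick {D : Multiset ℕ} (h : ∃ c, D.count c = 1) : D.count (pick D) = 1 := by
  obtain ⟨c, hc⟩ := h
  have hne : (simpleElems D).Nonempty := ⟨c, mem_simpleElems.2 hc⟩
  rw [← mem_simpleElems, pick]
  split_ifs
  · obtain ⟨d, hd, h⟩ := Finset.exists_mem_eq_sup _ hne id
    rw [h]
    exact hd
  · exact Finset.mem_coe.1 (Nat.sInf_mem (Finset.coe_nonempty.2 hne))

theorem pick_cons_of_lt {r : ℕ} {M : Multiset ℕ} (h₀ : 0 ∈ M) (h : ∀ c ∈ M, c < r) :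
    pick (r ::ₘ M) = r := by
  have hr : r ∉ M := fun hr => lt_irrefl _ (h r hr)
  rw [pick, if_pos (Multiset.mem_cons_of_mem h₀)]
  refine le_antisymm (Finset.sup_le fun c hc => ?_)
    (Finset.le_sup (f := id) (mem_simpleElems.2 (by simp [hr])))
  have hc' : c ∈ r ::ₘ M := Multiset.count_pos.1 (by rw [mem_simpleElems.1 hc]; exact one_pos)
  rcases Multiset.mem_cons.1 hc' with rfl | hc'
  · exact le_rfl
  · exact (h c hc').le

theorem pick_eq_of_le {r : ℕ} {D : Multiset ℕ} (h₀ : 0 ∉ D) (hr : D.count r = 1)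
    (h : ∀ c, D.count c = 1 → r ≤ c) : pick D = r := by
  rw [pick, if_neg h₀]
  refine le_antisymm (Nat.sInf_le (mem_simpleElems.2 hr)) ?_
  exact h _ (mem_simpleElems.1 (Finset.mem_coe.1
    (Nat.sInf_mem (s := (simpleElems D : Set ℕ)) ⟨r, mem_simpleElems.2 hr⟩)))

/-- If zero is the largest simple gap, no positive gap is simple. -/
theorem two_le_count_of_pick_eq_zero {M : Multiset ℕ} (hs : ∃ c, (0 ::ₘ M).count c = 1)
    (h : pick (0 ::ₘ M) = 0) : 0 ∉ M ∧ ∀ c ∈ M, 2 ≤ M.count c := by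
  have hc := count_pick hs
  rw [h, Multiset.count_cons_self] at hc
  have h₀ : 0 ∉ M := Multiset.count_eq_zero.1 (by omega)
  refine ⟨h₀, fun c hcM => ?_⟩
  by_contra hlt
  have hpos := Multiset.count_pos.2 hcM
  have hc0 : c ≠ 0 := by rintro rfl; exact h₀ hcM
  rw [pick, if_pos (Multiset.mem_cons_self _ _)] at h
  have hle : c ≤ (simpleElems (0 ::ₘ M)).sup id := Finset.le_sup (f := id) (mem_simpleElems.2 (by
    rw [Multiset.count_cons_of_ne hc0]; omega))
  omega

theorem selected_of_lt {l : List ℕ} (hl : l.length = k) (h₀ : 0 ∈ l)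
    (h : ∀ c ∈ l, c + l.sum < n) : Selected n k pick l := by
  have := h 0 h₀
  refine ⟨hl, by omega, pick_cons_of_lt h₀ fun c hc => ?_⟩
  have := h c hc
  omega

/-- Zeros are written in from the left. The bound keeps the omitted gap above every entry, and the
presence of a zero makes `pick` take the largest simple gap. -/
theorem reachable_zero_of_lt (B : List ℕ) : ∀ j : ℕ, j + B.length = k →
    0 ∈ List.replicate j 0 ++ B → (∀ c ∈ List.replicate j 0 ++ B, c + B.sum < n) →
    Relation.ReflTransGen (SelectedStep n k pick) (List.replicate j 0 ++ B)
      (List.replicate k 0) := by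
  induction B with
  | nil =>
    intro j hj _ _
    obtain rfl : j = k := by simpa using hj
    simpa using Relation.ReflTransGen.refl
  | cons d B ih =>
    intro j hj h₀ h
    have heq : List.replicate (j + 1) 0 ++ B = List.replicate j 0 ++ 0 :: B := by
      rw [List.replicate_succ']; simp
    have h' : ∀ c ∈ List.replicate j 0 ++ 0 :: B, c + B.sum < n := by
      intro c hc
      have hsum : (d :: B).sum = d + B.sum := List.sum_cons
      by_cases hc0 : c = 0
      · have := h 0 h₀; omega
      · have : c ∈ List.replicate j 0 ++ d :: B := by
          simp [hc0] at hc ⊢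
          exact Or.inr hc
        have := h c this
        omega
    have hlen : j + (B.length + 1) = k := hj
    refine Relation.ReflTransGen.head ⟨selected_of_lt (by simpa using hj) h₀ (by simpa using h),
      selected_of_lt (by simp; omega) (by simp) (by simpa using h'), _, B, d, 0, rfl, rfl⟩ ?_
    rw [← heq]
    exact ih (j + 1) (by omega) (by simp) (by rw [heq]; exact h')

/-- Clearing a maximal entry `a` adds `a` to an already positive omitted gap, which then exceeds all
entries. -/
theorem reachable_zero_of_sum_lt (hk : 0 < k) {l : List ℕ} (hl : Selected n k pick l)
    (h : l.sum < n) :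
    Relation.ReflTransGen (SelectedStep n k pick) l (List.replicate k 0) := by
  have hlen := hl.1
  obtain ⟨a, ha, hmax⟩ := l.toFinset.exists_max_image id (by
    rw [List.toFinset_nonempty_iff]; rintro rfl; simp at hlen; omega)
  simp only [List.mem_toFinset, id] at ha hmax
  obtain ⟨A, B, rfl⟩ := List.append_of_mem ha
  have hsum : (A ++ a :: B).sum = A.sum + (a + B.sum) := by simp
  have hsum' : (A ++ 0 :: B).sum = A.sum + B.sum := by simp
  have hlt : ∀ c ∈ A ++ 0 :: B, c + (A ++ 0 :: B).sum < n := by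
    intro c hc
    have : c ≤ a := by
      by_cases hc0 : c = 0
      · omega
      · apply hmax
        simp [hc0] at hc ⊢
        tauto
    omega
  have hlen' : (A ++ 0 :: B).length = k := by simpa using hlen
  have hreach := reachable_zero_of_lt (n := n) (A ++ 0 :: B) 0 (by rw [hlen', zero_add])
    (by simp) (by simpa using hlt)
  exact Relation.ReflTransGen.head
    ⟨hl, selected_of_lt hlen' (by simp) hlt, A, B, a, 0, rfl, rfl⟩ (by simpa using hreach)

/-- Used to escape from lists of sum `n`: one replacement opens a positive omitted gap `r`. -/
theorem reachable_zero_of_replace (hk : 0 < k) {l : List ℕ} (hl : Selected n k pick l)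
    {c c' r : ℕ} {M : Multiset ℕ} (h : (l : Multiset ℕ) = c ::ₘ M) (hr : 0 < r)
    (hsum : r + c' + M.sum = n) (hpick : pick (r ::ₘ c' ::ₘ M) = r) :
    Relation.ReflTransGen (SelectedStep n k pick) l (List.replicate k 0) := by
  have hlen := hl.1
  obtain ⟨A, B, rfl⟩ := List.append_of_mem (show c ∈ l by rw [← Multiset.mem_coe, h]; simp)
  have hM : M = ((A ++ B : List ℕ) : Multiset ℕ) := by
    rw [← Multiset.cons_inj_right c, ← h, Multiset.cons_coe, Multiset.coe_eq_coe]
    exact List.perm_middle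
  have hM' : ((A ++ c' :: B : List ℕ) : Multiset ℕ) = c' ::ₘ M := by
    rw [hM, Multiset.cons_coe, Multiset.coe_eq_coe]
    exact List.perm_middle
  have hs : (A ++ c' :: B).sum = c' + M.sum := by
    rw [← Multiset.sum_coe, hM', Multiset.sum_cons]
  have hr' : n - (A ++ c' :: B).sum = r := by omega
  have hl' : Selected n k pick (A ++ c' :: B) :=
    ⟨by simpa using hlen, by omega, by rw [hr', hM', hpick]⟩
  exact Relation.ReflTransGen.head ⟨hl, hl', A, B, c, c', rfl, rfl⟩
    (reachable_zero_of_sum_lt hk hl' (by omega))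

/-- Lowering one gap to create a gap of length one. -/
theorem reachable_zero_of_pred (hk : 0 < k) {l : List ℕ} (hl : Selected n k pick l) {a : ℕ}
    {M : Multiset ℕ} (h : (l : Multiset ℕ) = a ::ₘ M) (ha : 3 ≤ a) (hsum : a + M.sum = n)
    (h₀ : 0 ∉ M) (h₁ : 1 ∉ M) :
    Relation.ReflTransGen (SelectedStep n k pick) l (List.replicate k 0) := by
  have h0' : 0 ∉ (1 ::ₘ (a - 1) ::ₘ M) := by
    simp only [Multiset.mem_cons, not_or]
    exact ⟨by omega, by omega, h₀⟩
  refine reachable_zero_of_replace hk hl h (c' := a - 1) (r := 1) one_pos (by omega)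
    (pick_eq_of_le h0' ?_ fun c hc => ?_)
  · rw [Multiset.count_cons_self, Multiset.count_cons_of_ne (by omega),
      Multiset.count_eq_zero.2 h₁]
  · have : c ∈ (1 ::ₘ (a - 1) ::ₘ M) := Multiset.count_pos.1 (by omega)
    by_contra hlt
    obtain rfl : c = 0 := by omega
    exact h0' this

/-- Iterated, this peels off one value at a time and so enumerates the multiplicity patterns without
simple elements. -/
theorem exists_replicate_add {D : Multiset ℕ} (h : ∀ c ∈ D, 2 ≤ D.count c) :
    D = 0 ∨ ∃ (a j : ℕ) (D' : Multiset ℕ), 2 ≤ j ∧ D = Multiset.replicate j a + D' ∧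
      ∀ c ∈ D', 2 ≤ D'.count c := by
  rcases D.empty_or_exists_mem with rfl | ⟨a, ha⟩
  · exact Or.inl rfl
  refine Or.inr ⟨a, D.count a, D.filter (a ≠ ·), h a ha, ?_, fun c hc => ?_⟩
  · rw [← Multiset.filter_eq, Multiset.filter_add_not]
  · rw [Multiset.mem_filter] at hc
    rw [Multiset.count_filter_of_pos hc.2]
    exact h c hc.1

end SelectionRule

/-! ### The cases `t = 3, 4, 6`. -/

section Thresholds

variable {n k : ℕ}

/-- The rule `pick` gives a universal cycle once it is defined and the lists of differences
without a remaining gap are connected to the zero list. -/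
theorem exists_isMcycle_of_pick (hn : 3 ≤ n) (hk : 2 ≤ k)
    (hsimple : ∀ D : Multiset ℕ, Multiset.card D = k + 1 → (∀ c ∈ D, 2 ≤ D.count c) → D.sum ≠ n)
    (hfull : ∀ l : List ℕ, Selected n k pick l → l.sum = n → 0 ∉ l →
      (∀ c ∈ (l : Multiset ℕ), 2 ≤ (l : Multiset ℕ).count c) →
      Relation.ReflTransGen (SelectedStep n k pick) l (List.replicate k 0)) :
    ∃ a : ZMod ((n + (k + 1) - 1).choose (k + 1)) → Fin n, IsMcycle n (k + 1) a := by
  have : NeZero n := ⟨by omega⟩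
  have hex : ∀ D : Multiset ℕ, Multiset.card D = k + 1 → D.sum = n → ∃ c, D.count c = 1 := by
    intro D hD hsum
    by_contra! hne
    refine hsimple D hD (fun c hc => ?_) hsum
    have := Multiset.count_pos.2 hc
    have := hne c
    omega
  refine exists_isMcycle_of_selection (ρ := pick) (by omega)
    (fun D hD hsum => count_pick (hex D hD hsum)) ?_ ?_ ?_
  · obtain ⟨m, rfl⟩ : ∃ m, k = m + 2 := ⟨k - 2, by omega⟩
    refine selected_of_lt (by simp) (by simp) fun c hc => ?_
    simp at hc ⊢
    omega
  · refine selected_of_lt (by simp) (by simp; omega) fun c hc => ?_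
    simp at hc ⊢
    omega
  · intro l hl
    rcases hl.2.1.lt_or_eq with hlt | heq
    · exact reachable_zero_of_sum_lt (by omega) hl hlt
    · have hpick := hl.2.2
      rw [heq, Nat.sub_self] at hpick
      obtain ⟨h₀, h₂⟩ := two_le_count_of_pick_eq_zero
        (hex _ (by simp [hl.1]) (by simp [heq])) hpick
      exact hfull l hl heq (by simpa using h₀) h₂

/-- Three gaps without a simple one sum to `3a`. A full list is `a, a` with `2a = n`, and `n ≥ 5`
gives `a ≥ 3`. For `n = 4`, lowering `2` to `1` would not leave the new gap `1` simple. -/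
theorem exists_isMcycle_three (hn : 5 ≤ n) (hgcd : Nat.Coprime n 3) :
    ∃ a : ZMod ((n + 3 - 1).choose 3) → Fin n, IsMcycle n 3 a := by
  have h3 : ¬ 3 ∣ n := fun h => by
    have := Nat.dvd_gcd h (dvd_refl 3); rw [hgcd] at this; omega
  refine exists_isMcycle_of_pick (k := 2) (by omega) le_rfl ?_ ?_
  · rintro D hD h rfl
    obtain rfl | ⟨a, j, D', hj, rfl, h'⟩ := exists_replicate_add h
    · simp at hD
    obtain rfl | ⟨b, i, D'', hi, rfl, h''⟩ := exists_replicate_add h'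
    · simp at hD hn h3; subst hD; omega
    · simp at hD; omega
  · intro l hl hsum h₀ h
    have hlen : Multiset.card (l : Multiset ℕ) = 2 := hl.1
    have hsum' : (l : Multiset ℕ).sum = n := hsum
    have h₀' : 0 ∉ (l : Multiset ℕ) := h₀
    obtain h | ⟨a, j, D', hj, hD, h'⟩ := exists_replicate_add h
    · rw [h] at hlen; simp at hlen
    rw [hD] at hlen hsum' h₀'
    obtain rfl | ⟨b, i, D'', hi, rfl, h''⟩ := exists_replicate_add h'
    · obtain rfl : j = 2 := by simpa using hlen
      simp at hsum' h₀'
      refine reachable_zero_of_pred (a := a) (M := {a}) (by omega) hl hD (by omega)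
        (by simp; omega) ?_ ?_ <;> simp <;> omega
    · simp at hlen; omega

/-- Sums `4a` and `2a + 2b` are even. A full list is `a, a, a`, with `a ≥ 3` because `n ≥ 5`. -/
theorem exists_isMcycle_four (hn : 5 ≤ n) (hgcd : Nat.Coprime n 4) :
    ∃ a : ZMod ((n + 4 - 1).choose 4) → Fin n, IsMcycle n 4 a := by
  have h2 : ¬ 2 ∣ n := fun h => by
    have := Nat.dvd_gcd h (show 2 ∣ 4 by norm_num); rw [hgcd] at this; omega
  refine exists_isMcycle_of_pick (k := 3) (by omega) (by omega) ?_ ?_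
  · rintro D hD h rfl
    obtain rfl | ⟨a, j, D', hj, rfl, h'⟩ := exists_replicate_add h
    · simp at hD
    obtain rfl | ⟨b, i, D'', hi, rfl, h''⟩ := exists_replicate_add h'
    · simp at hD hn h2; subst hD; omega
    obtain rfl | ⟨c, m, D''', hm, rfl, h'''⟩ := exists_replicate_add h''
    · simp at hD hn h2
      obtain ⟨rfl, rfl⟩ : j = 2 ∧ i = 2 := by omega
      omega
    · simp at hD; omega
  · intro l hl hsum h₀ h
    have hlen : Multiset.card (l : Multiset ℕ) = 3 := hl.1
    have hsum' : (l : Multiset ℕ).sum = n := hsum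
    have h₀' : 0 ∉ (l : Multiset ℕ) := h₀
    obtain h | ⟨a, j, D', hj, hD, h'⟩ := exists_replicate_add h
    · rw [h] at hlen; simp at hlen
    rw [hD] at hlen hsum' h₀'
    obtain rfl | ⟨b, i, D'', hi, rfl, h''⟩ := exists_replicate_add h'
    · obtain rfl : j = 3 := by simpa using hlen
      simp at hsum' h₀'
      refine reachable_zero_of_pred (a := a) (M := {a, a}) (by omega) hl hD (by omega)
        (by simp; omega) ?_ ?_ <;> simp <;> omega
    · simp at hlen; omega

/-- As `n` is odd, so is `a`. If neither value is `1`, lower one `a` by one. Otherwise lower an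
entry of the other value to `1`. The omitted gap is then `b - 1` or `a - 1`, the smallest simple
gap, and `n ≥ 11` keeps it above `1`. -/
theorem reachable_zero_of_three_two (hn : 11 ≤ n) (h2 : ¬ 2 ∣ n) {l : List ℕ}
    (hl : Selected n 5 pick l) (hsum : l.sum = n) (h₀ : 0 ∉ l) {a b : ℕ}
    (hD : (l : Multiset ℕ) = Multiset.replicate 3 a + Multiset.replicate 2 b) :
    Relation.ReflTransGen (SelectedStep n 5 pick) l (List.replicate 5 0) := by
  have hD' : (l : Multiset ℕ) = a ::ₘ a ::ₘ a ::ₘ b ::ₘ b ::ₘ 0 := by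
    rw [hD]; rfl
  have hsum' : (l : Multiset ℕ).sum = n := hsum
  have h₀' : 0 ∉ (l : Multiset ℕ) := h₀
  rw [hD'] at hsum' h₀'
  simp at hsum' h₀'
  obtain ha | ha : a = 1 ∨ 3 ≤ a := by omega
  · subst ha
    have hp : (l : Multiset ℕ) = b ::ₘ b ::ₘ 1 ::ₘ 1 ::ₘ 1 ::ₘ 0 := by
      rw [hD, add_comm]; rfl
    refine reachable_zero_of_replace (by omega) hl hp (c' := 1) (r := b - 1) (by omega)
      (by simp; omega) (pick_eq_of_le ?_ ?_ fun c hc => ?_)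
    · simp; omega
    · simp only [Multiset.count_cons, Multiset.count_zero]
      split_ifs <;> omega
    · simp only [Multiset.count_cons, Multiset.count_zero] at hc
      split_ifs at hc <;> omega
  by_cases hb : b = 1
  · subst hb
    refine reachable_zero_of_replace (by omega) hl hD' (c' := 1) (r := a - 1) (by omega)
      (by simp; omega) (pick_eq_of_le ?_ ?_ fun c hc => ?_)
    · simp; omega
    · simp only [Multiset.count_cons, Multiset.count_zero]
      split_ifs <;> omega
    · simp only [Multiset.count_cons, Multiset.count_zero] at hc
      split_ifs at hc <;> omega
  · refine reachable_zero_of_pred (by omega) hl hD' ha (by simp; omega) ?_ ?_ <;> simp <;> omega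

theorem exists_isMcycle_six (hn : 11 ≤ n) (hgcd : Nat.Coprime n 6) :
    ∃ a : ZMod ((n + 6 - 1).choose 6) → Fin n, IsMcycle n 6 a := by
  have h2 : ¬ 2 ∣ n := fun h => by
    have := Nat.dvd_gcd h (show 2 ∣ 6 by norm_num); rw [hgcd] at this; omega
  have h3 : ¬ 3 ∣ n := fun h => by
    have := Nat.dvd_gcd h (show 3 ∣ 6 by norm_num); rw [hgcd] at this; omega
  refine exists_isMcycle_of_pick (k := 5) (by omega) (by omega) ?_ ?_
  · rintro D hD h rfl
    obtain rfl | ⟨a, j, D', hj, rfl, h'⟩ := exists_replicate_add h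
    · simp at hD
    obtain rfl | ⟨b, i, D'', hi, rfl, h''⟩ := exists_replicate_add h'
    · simp at hD h2; subst hD; omega
    obtain rfl | ⟨c, m, D''', hm, rfl, h'''⟩ := exists_replicate_add h''
    · simp at hD h2 h3
      -- The sums `2a + 4b` and `4a + 2b` are even, and `3a + 3b` is divisible by three.
      obtain ⟨rfl, rfl⟩ | ⟨rfl, rfl⟩ | ⟨rfl, rfl⟩ :
        (j = 2 ∧ i = 4) ∨ (j = 3 ∧ i = 3) ∨ (j = 4 ∧ i = 2) := by omega
      all_goals omega
    obtain rfl | ⟨d, q, E, hq, rfl, _⟩ := exists_replicate_add h'''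
    · simp at hD h2
      obtain ⟨rfl, rfl, rfl⟩ : j = 2 ∧ i = 2 ∧ m = 2 := by omega
      omega
    · simp at hD; omega
  · intro l hl hsum h₀ h
    have hlen : Multiset.card (l : Multiset ℕ) = 5 := hl.1
    have hsum' : (l : Multiset ℕ).sum = n := hsum
    have h₀' : 0 ∉ (l : Multiset ℕ) := h₀
    obtain h | ⟨a, j, D', hj, hD, h'⟩ := exists_replicate_add h
    · rw [h] at hlen; simp at hlen
    rw [hD] at hlen hsum' h₀'
    obtain rfl | ⟨b, i, D'', hi, rfl, h''⟩ := exists_replicate_add h'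
    · obtain rfl : j = 5 := by simpa using hlen
      simp at hsum' h₀'
      refine reachable_zero_of_pred (a := a) (M := {a, a, a, a}) (by omega) hl hD (by omega)
        (by simp; omega) ?_ ?_ <;> simp <;> omega
    obtain rfl | ⟨c, m, D''', hm, rfl, h'''⟩ := exists_replicate_add h''
    · simp at hlen
      obtain ⟨rfl, rfl⟩ | ⟨rfl, rfl⟩ : (j = 3 ∧ i = 2) ∨ (j = 2 ∧ i = 3) := by omega
      · exact reachable_zero_of_three_two hn h2 hl hsum h₀ (by simpa using hD)
      · exact reachable_zero_of_three_two hn h2 hl hsum h₀ (a := b) (b := a)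
          (by rw [hD, add_comm]; simp)
    · simp at hlen; omega

/-- A universal cycle for the `3`-multisets of a `4`-element set. -/
def mcycleFourThree : ZMod 20 → Fin 4 :=
  ![0, 0, 0, 1, 1, 1, 2, 0, 2, 0, 3, 1, 3, 1, 2, 2, 2, 3, 3, 3]

set_option maxRecDepth 10000 in
theorem isMcycle_four_three : IsMcycle 4 3 mcycleFourThree := by
  change ∀ s : Multiset (Fin 4), Multiset.card s = 3 → ∃! i : ZMod 20,
    (Multiset.range 3).map (fun j : ℕ => mcycleFourThree (i + (j : ZMod 20) : ZMod 20)) = s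
  intro s hs
  obtain ⟨x, y, z, rfl⟩ := Multiset.card_eq_three.1 hs
  clear hs
  simp only [ExistsUnique]
  revert x y z
  decide

end Thresholds

theorem mainTheorem1 (t n : ℕ) (ht : t ∈ ({3, 4, 6} : Set ℕ)) (hn : nZero t ≤ n)
    (hgcd : Nat.Coprime n t) :
    ∃ a : ZMod ((n + t - 1).choose t) → Fin n, IsMcycle n t a := by
  simp only [Set.mem_insert_iff, Set.mem_singleton_iff] at ht
  rcases ht with rfl | rfl | rfl
  · rcases (show 4 ≤ n from hn).eq_or_lt with rfl | h
    · exact ⟨_, isMcycle_four_three⟩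
    · exact exists_isMcycle_three h hgcd
  · exact exists_isMcycle_four hn hgcd
  · exact exists_isMcycle_six hn hgcd
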